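/- **Setting.** Let $1\le m\le n$, $n\ge 2$. For $A\in\mathbb R^{m\times n}$ write $\|A\|_F$ for the Frobenius norm, $\|A\|_{\max}=\max_{i,j}|A_{ij}|$, $\langle A,B\rangle=\sum_{ij}A_{ij}B_{ij}$, and $\alpha_{\mathrm{sp}}(A)=\sqrt{mn}\,\|A\|_{\max}/\|A\|_F$ (spikiness). Let $\mathcal R$ be a norm on $\mathbb R^{m\times n}$ with dual norm $\mathcal R^*(A)=\sup_{\mathcal R(B)\le 1}\langle B,A\rangle$, let $\mathcal M\subseteq\overline{\mathcal M}\subseteq\mathbb R^{m\times n}$ be subspaces, $\overline{\mathcal M}\ne\{0\}$, and assume that $\mathcal R$ is decomposable: $\mathcal R(A+B)=\mathcal R(A)+\mathcal R(B)$ for $A\in\mathcal M$, $B\in\overline{\mathcal M}^{\perp}$. Put $\Psi(\overline{\mathcal M})=\sup_{0\ne A\in\overline{\mathcal M}}\mathcal R(A)/\|A\|_F$ and $\Psi_{\min}=\inf_{A\neq 0}\mathcal R(A)/\|A\|_F$. Let $G:\mathbb R\to\mathbb R$ be the (strictly convex, analytic) log-partition function of a natural exponential family on $\mathbb R$ with densities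 $h(x)e^{x\theta-G(\theta)}$, $\theta\in\mathbb R$, and assume $G''(u)\ge e^{-\eta|u|}$ for all $u\in\mathbb{R}$, where $\eta>0$. Let $g=G'$ and $B_G(x,y)=G(x)-G(y)-g(y)(x-y)$. Let $\Theta^*\in\mathcal M$ with $\|\Theta^*\|_{\max}\le\alpha^*/\sqrt{mn}$, $\alpha^*>0$. The random matrix $X$ has independent entries, $X_{ij}$ having density $h(x)e^{x\Theta^*_{ij}-G(\Theta^*_{ij})}$. Independently of $X$, $\Omega$ is a list of $|\Omega|$ independent index pairs, uniform on $[m]\times[n]$, counted with multiplicity; assume $|\Omega|\le n^2$. Let $\mathcal P_\Omega(A)=\sum_{(i,j)\in\Omega}A_{ij}e_ie_j^{\top}$ and $$\kappa_{\mathcal R}(n,|\Omega|)=\mathbb E\Big[\tfrac{\sqrt{mn}}{|\Omega|}\,\mathcal R^*\Big(\sum_{(i,j)\in\Omega}\epsilon_{ij}e_ie_j^{\top}\Big)\Big],$$ with independent random signs $\epsilon_{ij}$, one for each element of the list and independent of $\Omega$. For $\lambda>0$ let $\widehat\Theta$ be a minimizer of $$\frac{mn}{|\Omega|}\sum_{(i,j)\in\Omega}\big(G(\Theta_{ij})-X_{ij}\Theta_{ij}\big)+\lambda\mathcal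 R(\Theta)\quad\text{over}\quad\|\Theta\|_{\max}\le\frac{\alpha^*}{\sqrt{mn}},$$ and let $\widehat\Delta=\widehat\Theta-\Theta^*$. **Theorem 2 (Restricted Strong Convexity).** For every $\beta>0$ there are constants $\bar c>0$ and $K_\beta>0$, depending only on $\beta$, such that for every $c_0\ge\bar c$ the following holds in the setting above whenever $|\Omega|\ge c_0\Psi^2(\overline{\mathcal M})\,n\log n$. Set $$\mu_{\mathcal L}=e^{-2\eta\alpha^*/\sqrt{mn}}\Big(K_\beta-\frac{64}{c_0}\sqrt{\frac{|\Omega|\,\kappa_{\mathcal R}^2(n,|\Omega|)}{n\log n}}\Big).$$ With probability $>1-4e^{-(1+\beta)\Psi_{\min}^4\log^2 n}$, for every $\lambda>0$ and every minimizer $\widehat\Theta$ as above: if $\frac{\lambda}{2}\ge\frac{mn}{|\Omega|}\mathcal R^*\big(\mathcal P_\Omega(X-g(\Theta^*))\big)$ and $\alpha_{\mathrm{sp}}(\widehat\Delta)\le\frac{1}{c_0\Psi(\overline{\mathcal M})}\sqrt{\frac{|\Omega|}{n\log n}}$, then $$\frac{mn}{|\Omega|}\sum_{(i,j)\in\Omega}B_G(\widehat\Theta_{ij},\Theta^*_{ij})\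 \ge\ \mu_{\mathcal L}\,\|\widehat\Delta\|_F^2 .$$ (If $\widehat\Delta=0$ the spikiness condition counts as satisfied.) -/

import Mathlib

open MeasureTheory ProbabilityTheory
open scoped BigOperators

noncomputable section

namespace MatrixCompletion

/-- Real `m × n` matrices. -/
abbrev Mat (m n : ℕ) : Type := Matrix (Fin m) (Fin n) ℝ

section Norms

variable {m n : ℕ}

/-- The trace inner product `⟨A, B⟩ = ∑ᵢⱼ Aᵢⱼ Bᵢⱼ`. -/
def frobInner (A B : Mat m n) : ℝ := ∑ i, ∑ j, A i j * B i j

/-- The Frobenius norm. -/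
def frobNorm (A : Mat m n) : ℝ := Real.sqrt (frobInner A A)

/-- The maximum norm, the largest absolute value of an entry. -/
def maxNorm (A : Mat m n) : ℝ := ⨆ p : Fin m × Fin n, |A p.1 p.2|

/-- The spikiness ratio `√(mn) ‖A‖_max / ‖A‖_F`. -/
def spikiness (A : Mat m n) : ℝ :=
  Real.sqrt ((m : ℝ) * n) * maxNorm A / frobNorm A

/-- A seminorm on matrices is a norm if it only vanishes at `0`. -/
def IsNorm (R : Seminorm ℝ (Mat m n)) : Prop := ∀ A, R A = 0 → A = 0

/-- The dual norm `R*(A) = sup {⟨B, A⟩ : R(B) ≤ 1}`. -/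
def dualNorm (R : Seminorm ℝ (Mat m n)) (A : Mat m n) : ℝ :=
  sSup {x | ∃ B : Mat m n, R B ≤ 1 ∧ x = frobInner B A}

/-- The maximum subspace compatibility constant: the supremum of `R(A) / ‖A‖_F` over the nonzero
matrices `A` of the subspace. -/
def psiMax (R : Seminorm ℝ (Mat m n)) (M : Submodule ℝ (Mat m n)) : ℝ :=
  sSup {x | ∃ A ∈ M, A ≠ 0 ∧ x = R A / frobNorm A}

/-- The minimum compatibility constant: the infimum of `R(A) / ‖A‖_F` over all nonzero matrices. -/
def psiMin (R : Seminorm ℝ (Mat m n)) : ℝ :=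
  sInf {x | ∃ A : Mat m n, A ≠ 0 ∧ x = R A / frobNorm A}

/-- `R` is decomposable over `(M, Mbar^⊥)`: `R(A + B) = R(A) + R(B)` for `A ∈ M` and every `B`
orthogonal to `Mbar`. -/
def IsDecomposable (R : Seminorm ℝ (Mat m n)) (M Mbar : Submodule ℝ (Mat m n)) : Prop :=
  ∀ A ∈ M, ∀ B : Mat m n, (∀ C ∈ Mbar, frobInner C B = 0) → R (A + B) = R A + R B

end Norms

section ExpFamily

/-- `G` is the log-partition function of the natural exponential family on `ℝ` with base measure
`ν` (the measure `h(x) dx`, or `h` times a counting measure) and natural parameter space `ℝ`;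
it is strictly convex and analytic. -/
structure IsLogPartition (ν : Measure ℝ) (G : ℝ → ℝ) : Prop where
  integrable : ∀ θ : ℝ, Integrable (fun x : ℝ => Real.exp (x * θ)) ν
  eq_log : ∀ θ : ℝ, G θ = Real.log (∫ x, Real.exp (x * θ) ∂ν)
  strictConvex : StrictConvexOn ℝ Set.univ G
  analytic : AnalyticOnNhd ℝ G Set.univ

/-- The member of the natural exponential family with parameter `θ`: density
`exp (x θ - G θ)` with respect to the base measure `ν`. -/
def expFamily (ν : Measure ℝ) (G : ℝ → ℝ) (θ : ℝ) : Measure ℝ :=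
  ν.withDensity fun x => ENNReal.ofReal (Real.exp (x * θ - G θ))

/-- The Bregman divergence `B_G(x, y) = G(x) - G(y) - G'(y) (x - y)`. -/
def bregman (G : ℝ → ℝ) (x y : ℝ) : ℝ := G x - G y - deriv G y * (x - y)

end ExpFamily

section Sampling

variable {m n N : ℕ}

/-- `P_Ω(A) = ∑_{(i,j) ∈ Ω} A_ij e_i e_jᵀ` for a list `Ω` of `N` index pairs, counted with
multiplicity. -/
def proj (Om : Fin N → Fin m × Fin n) (A : Mat m n) : Mat m n :=
  ∑ k, Matrix.single (Om k).1 (Om k).2 (A (Om k).1 (Om k).2)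

/-- `κ_R(n, N) = E [(√(mn) / N) R*(∑ₖ εₖ e_{iₖ} e_{jₖ}ᵀ)]`, where the `N` index pairs `(iₖ, jₖ)` are
independent and uniform on `[m] × [n]` and the `εₖ` are independent random signs, independent of the
pairs; that is, the average over all lists of pairs and all lists of signs. -/
def kappa (R : Seminorm ℝ (Mat m n)) (N : ℕ) : ℝ :=
  𝔼 Om : Fin N → Fin m × Fin n, 𝔼 ε : Fin N → ℤˣ,
    Real.sqrt ((m : ℝ) * n) / N *
      dualNorm R (∑ k, Matrix.single (Om k).1 (Om k).2 (((ε k : ℤˣ) : ℤ) : ℝ))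

/-- The regularized negative log-likelihood
`(mn / N) ∑_{(i,j) ∈ Ω} (G(Θ_ij) - X_ij Θ_ij) + lam R(Θ)`. -/
def objective (G : ℝ → ℝ) (R : Seminorm ℝ (Mat m n)) (lam : ℝ)
    (Om : Fin N → Fin m × Fin n) (X Θ : Mat m n) : ℝ :=
  (m : ℝ) * n / N *
      ∑ k, (G (Θ (Om k).1 (Om k).2) - X (Om k).1 (Om k).2 * Θ (Om k).1 (Om k).2) +
    lam * R Θ

/-- `Θhat` minimizes the objective over the matrices `Θ` with `‖Θ‖_max ≤ α / √(mn)`. -/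
def IsEstimate (G : ℝ → ℝ) (R : Seminorm ℝ (Mat m n)) (lam α : ℝ)
    (Om : Fin N → Fin m × Fin n) (X Θhat : Mat m n) : Prop :=
  maxNorm Θhat ≤ α / Real.sqrt ((m : ℝ) * n) ∧
    ∀ Θ : Mat m n, maxNorm Θ ≤ α / Real.sqrt ((m : ℝ) * n) →
      objective G R lam Om X Θhat ≤ objective G R lam Om X Θ

/-- The curvature constant
`μ = exp (-2 η α / √(mn)) (K - (64 / c₀) √(N κ_R(n, N)² / (n log n)))`. -/
def muL (R : Seminorm ℝ (Mat m n)) (N : ℕ) (η α K c₀ : ℝ) : ℝ :=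
  Real.exp (-(2 * η * α / Real.sqrt ((m : ℝ) * n))) *
    (K - 64 / c₀ * Real.sqrt (N * kappa R N ^ 2 / (n * Real.log n)))

/-- The observation model on a probability space: `Om` is a list of `N` independent uniform index
pairs, the entries of `X` are independent, `X_ij` has the law of the exponential family with
parameter `Θstar_ij`, and `X` is independent of `Om`. -/
structure IsObservationModel {S : Type*} [MeasurableSpace S] (P : Measure S)
    (ν : Measure ℝ) (G : ℝ → ℝ) (Θstar : Mat m n)
    (Om : Fin N → S → Fin m × Fin n) (X : Fin m → Fin n → S → ℝ) : Prop where
  om_law : ∀ k, HasLaw (Om k) (uniformOn (Set.univ : Set (Fin m × Fin n))) P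
  om_indep : iIndepFun Om P
  x_law : ∀ i j, HasLaw (X i j) (expFamily ν G (Θstar i j)) P
  x_indep : iIndepFun (fun p : Fin m × Fin n => X p.1 p.2) P
  indep : IndepFun (fun s k => Om k s) (fun s (p : Fin m × Fin n) => X p.1 p.2 s) P

end Sampling

end MatrixCompletion

end

open MatrixCompletion

/-! The exceptional event involves the sampled indices only; off it, everything is deterministic in
the observations, hence uniform in `lam` and in the minimizer. Write `D = Θhat - Θstar`. Comparing
the objective at the two matrices, with nonnegative Bregman divergences and `lam / 2` dominating the
dual norm of the noise, gives `R (Θstar + D) ≤ R Θstar + R D / 2`. Decomposability turns this into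
the cone condition `R D ≤ 4 Ψ ‖D‖_F` (`IsEstimate.regularizer_error_le`). By Taylor's formula each
Bregman term is at least a constant times the squared entry of `D` (`bregman_lower_bound`), so it
remains to bound the sampled sum of squares from below, uniformly over cone matrices of spikiness at
most `a` (`exists_exceptional_samples`). That bound is homogeneous in `D`, so unit Frobenius norm
suffices and no peeling over scales is needed. The worst deficit of the sampled squares below their
mean is the supremum of an empirical process. Symmetrization, contraction (squares to linear terms)
and duality bound its mean by a multiple of `kappa`. Changing one sample moves it by at most `a ^
2`, so McDiarmid's inequality bounds the chance of exceeding the mean by `N / 2` by `exp (-N / (8 a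
^ 4))`. The choice of `a` and `N ≤ n ^ 2` make this small enough (`le_exponent_of_scale`). -/

namespace MatrixCompletion

/-! ### Concentration for uniform averages over finite powers. -/

section FiniteAverages

variable {ι : Type*} [Fintype ι]

theorem expect_fin_succ {N : ℕ} (f : (Fin (N + 1) → ι) → ℝ) :
    𝔼 ω, f ω = 𝔼 a, 𝔼 y : Fin N → ι, f (Fin.cons a y) := by
  rw [← Fintype.expect_equiv (Fin.consEquiv fun _ : Fin (N + 1) => ι)
    (fun p => f (Fin.cons p.1 p.2)) f (fun p => rfl), ← Finset.univ_product_univ,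
    Finset.expect_product]

theorem expect_sign (f : ℤˣ → ℝ) : 𝔼 e, f e = (f 1 + f (-1)) / 2 := by
  rw [Fintype.expect_eq_sum_div_card]
  simp [Fintype.card_units_int]

theorem expect_coord [Nonempty ι] {N : ℕ} (k : Fin N) (h : ι → ℝ) :
    𝔼 ω : Fin N → ι, h (ω k) = 𝔼 i, h i := by
  induction N with
  | zero => exact k.elim0
  | succ N ih =>
    rw [expect_fin_succ]
    refine Fin.cases ?_ (fun j => ?_) k
    · simp
    · simp [ih]

/-- Hoeffding's lemma for the uniform average over a finite type. -/
theorem expect_exp_centered_le [Nonempty ι] (h : ι → ℝ) {c : ℝ} (hc : 0 < c)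
    (hh : ∀ a b, |h a - h b| ≤ c) (l : ℝ) :
    𝔼 a, Real.exp (l * (h a - 𝔼 b, h b)) ≤ Real.exp ((l * c) ^ 2 / 2) := by
  have hY : ∀ a, |(h a - 𝔼 b, h b) / c| ≤ 1 := fun a => by
    rw [abs_div, abs_of_pos hc, div_le_one hc]
    have : h a - 𝔼 b, h b = 𝔼 b, (h a - h b) := by
      rw [Finset.expect_sub_distrib, Fintype.expect_const]
    rw [this]
    exact (Finset.abs_expect_le _ _).trans
      (Finset.expect_le Finset.univ_nonempty fun b _ => hh a b)
  have h0 : 𝔼 a, (h a - 𝔼 b, h b) / c = 0 := by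
    rw [← Finset.expect_div, Finset.expect_sub_distrib, Fintype.expect_const, sub_self, zero_div]
  -- Convexity puts the exponential below its chord on `[-1, 1]`, and the linear term averages to
  -- zero. This gives the constant `1 / 2`, not the sharp `1 / 8`.
  calc 𝔼 a, Real.exp (l * (h a - 𝔼 b, h b))
      ≤ 𝔼 a, (Real.cosh (l * c) + (h a - 𝔼 b, h b) / c * Real.sinh (l * c)) := by
        refine Finset.expect_le_expect fun a _ => ?_
        have := Real.exp_mul_le_cosh_add_mul_sinh (hY a) (l * c)
        rwa [show (h a - 𝔼 b, h b) / c * (l * c) = l * (h a - 𝔼 b, h b) by field_simp] at this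
    _ = Real.cosh (l * c) := by
        rw [Finset.expect_add_distrib, Fintype.expect_const, ← Finset.expect_mul, h0, zero_mul,
          add_zero]
    _ ≤ _ := Real.cosh_le_exp_half_sq _

/-- Exponential moment form of the bounded differences inequality. -/
theorem expect_exp_le_of_bounded_diff [Nonempty ι] {c : ℝ} (hc : 0 < c) (l : ℝ) {N : ℕ}
    (f : (Fin N → ι) → ℝ) (hf : ∀ ω k i, |f ω - f (Function.update ω k i)| ≤ c) :
    𝔼 ω, Real.exp (l * (f ω - 𝔼 ω', f ω')) ≤ Real.exp (N * ((l * c) ^ 2 / 2)) := by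
  induction N with
  | zero =>
    have h1 : ∀ ω, f ω = f default := fun ω => congrArg f (Subsingleton.elim _ _)
    simp [h1]
  | succ N ih =>
    -- Averaging out the first coordinate preserves the bounded differences. What remains, for fixed
    -- `y`, is a centred function of one coordinate, handled by Hoeffding's lemma.
    set g : (Fin N → ι) → ℝ := fun y => 𝔼 a, f (Fin.cons a y) with hg
    have hE : 𝔼 ω, f ω = 𝔼 y, g y := by rw [expect_fin_succ, Finset.expect_comm]
    have hgd : ∀ y k i, |g y - g (Function.update y k i)| ≤ c := fun y k i => by
      simp only [hg]
      rw [← Finset.expect_sub_distrib]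
      refine (Finset.abs_expect_le _ _).trans
        (Finset.expect_le Finset.univ_nonempty fun a _ => ?_)
      rw [Fin.cons_update]
      exact hf _ _ _
    have hin : ∀ y, 𝔼 a, Real.exp (l * (f (Fin.cons a y) - g y)) ≤ Real.exp ((l * c) ^ 2 / 2) :=
      fun y => expect_exp_centered_le (fun a => f (Fin.cons a y)) hc (fun a b => by
        have := hf (Fin.cons a y) 0 b
        rwa [Fin.update_cons_zero] at this) l
    rw [hE, expect_fin_succ, Finset.expect_comm]
    calc 𝔼 y : Fin N → ι, 𝔼 a, Real.exp (l * (f (Fin.cons a y) - 𝔼 y, g y))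
        = 𝔼 y : Fin N → ι, (𝔼 a, Real.exp (l * (f (Fin.cons a y) - g y))) *
            Real.exp (l * (g y - 𝔼 y, g y)) := by
          refine Finset.expect_congr rfl fun y _ => ?_
          rw [Finset.expect_mul]
          refine Finset.expect_congr rfl fun a _ => ?_
          rw [← Real.exp_add]
          ring_nf
      _ ≤ 𝔼 y : Fin N → ι, Real.exp ((l * c) ^ 2 / 2) * Real.exp (l * (g y - 𝔼 y, g y)) :=
          Finset.expect_le_expect fun y _ =>
            mul_le_mul_of_nonneg_right (hin y) (Real.exp_pos _).le
      _ ≤ Real.exp ((l * c) ^ 2 / 2) * Real.exp (N * ((l * c) ^ 2 / 2)) := by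
          rw [← Finset.mul_expect]
          exact mul_le_mul_of_nonneg_left (ih g hgd) (Real.exp_pos _).le
      _ = _ := by
          rw [← Real.exp_add]
          push_cast
          ring_nf

/-- McDiarmid's inequality for the uniform distribution on a finite power. -/
theorem expect_indicator_le_of_bounded_diff [Nonempty ι] {c t : ℝ} (hc : 0 < c) (ht : 0 ≤ t)
    {N : ℕ} (hN : 0 < N) (f : (Fin N → ι) → ℝ)
    (hf : ∀ ω k i, |f ω - f (Function.update ω k i)| ≤ c) :
    (𝔼 ω, {ω | 𝔼 ω', f ω' + t ≤ f ω}.indicator (fun _ => (1 : ℝ)) ω) ≤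
      Real.exp (-(t ^ 2 / (2 * (N * c ^ 2)))) := by
  have hN' : (0 : ℝ) < N := by exact_mod_cast hN
  -- The minimizer of the Chernoff exponent `N (l c) ^ 2 / 2 - l t`.
  set l : ℝ := t / (N * c ^ 2) with hl
  have hl0 : 0 ≤ l := by positivity
  calc (𝔼 ω, {ω | 𝔼 ω', f ω' + t ≤ f ω}.indicator (fun _ => (1 : ℝ)) ω)
      ≤ 𝔼 ω, Real.exp (l * (f ω - 𝔼 ω', f ω')) * Real.exp (-(l * t)) := by
        refine Finset.expect_le_expect fun ω _ => ?_
        refine Set.indicator_apply_le' (fun h => ?_) (fun _ => by positivity)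
        rw [← Real.exp_add]
        refine Real.one_le_exp ?_
        have : t ≤ f ω - 𝔼 ω', f ω' := by
          have h' : 𝔼 ω', f ω' + t ≤ f ω := h
          linarith
        nlinarith
    _ ≤ Real.exp (N * ((l * c) ^ 2 / 2)) * Real.exp (-(l * t)) := by
        rw [← Finset.expect_mul]
        exact mul_le_mul_of_nonneg_right (expect_exp_le_of_bounded_diff hc l f hf)
          (Real.exp_pos _).le
    _ = _ := by
        rw [← Real.exp_add, hl]
        congr 1
        field_simp
        ring

end FiniteAverages

/-! ### Contraction and symmetrization for suprema of random processes. -/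

section Suprema

variable {T : Type*}

theorem bddAbove_of_abs_le {F : T → ℝ} {C : ℝ} (h : ∀ t, |F t| ≤ C) :
    BddAbove (Set.range F) :=
  ⟨C, by rintro _ ⟨t, rfl⟩; exact (le_abs_self _).trans (h t)⟩

theorem abs_sum_le_of_abs_le {N : ℕ} {F : Fin N → ℝ} {C : ℝ} (h : ∀ k, |F k| ≤ C) :
    |∑ k, F k| ≤ N * C :=
  (Finset.abs_sum_le_sum_abs _ _).trans
    ((Finset.sum_le_sum fun k _ => h k).trans (by simp))

theorem abs_sign_mul (e : ℤˣ) (x : ℝ) : |((e : ℤ) : ℝ) * x| = |x| := by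
  rcases Int.units_eq_one_or e with rfl | rfl <;> simp

/-- One sign of the contraction principle. For points `s`, `t` the left side is at most `A s + A t +
|ψ s - ψ t|`; the sign of `ψ s - ψ t` decides which point serves in which supremum on the right. -/
theorem ciSup_add_ciSup_sub_le [Nonempty T] {A φ ψ : T → ℝ} {C D : ℝ}
    (hA : ∀ t, |A t| ≤ C) (hψ : ∀ t, |ψ t| ≤ D)
    (h : ∀ s t, |φ s - φ t| ≤ |ψ s - ψ t|) :
    (⨆ t, (A t + φ t)) + (⨆ t, (A t - φ t)) ≤ (⨆ t, (A t + ψ t)) + ⨆ t, (A t - ψ t) := by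
  have b1 : BddAbove (Set.range fun t => A t + ψ t) :=
    bddAbove_of_abs_le (C := C + D) fun t => (abs_add_le _ _).trans (add_le_add (hA t) (hψ t))
  have b2 : BddAbove (Set.range fun t => A t - ψ t) :=
    bddAbove_of_abs_le (C := C + D) fun t => (abs_sub _ _).trans (add_le_add (hA t) (hψ t))
  rw [← le_sub_iff_add_le]
  refine ciSup_le fun s => ?_
  rw [le_sub_iff_add_le, ← le_sub_iff_add_le']
  refine ciSup_le fun t => ?_
  have h1 := le_ciSup b1 s
  have h2 := le_ciSup b2 t
  have h3 := le_ciSup b1 t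
  have h4 := le_ciSup b2 s
  have h5 := (le_abs_self _).trans (h s t)
  rcases abs_cases (ψ s - ψ t) with ⟨h6, -⟩ | ⟨h6, -⟩ <;> rw [h6] at h5 <;> linarith

/-- The contraction principle for Rademacher averages. -/
theorem expect_ciSup_sign_sum_le [Nonempty T] {D : ℝ} {N : ℕ} (φ ψ : Fin N → T → ℝ)
    (hφ : ∀ k t, |φ k t| ≤ D) (hψ : ∀ k t, |ψ k t| ≤ D)
    (h : ∀ k s t, |φ k s - φ k t| ≤ |ψ k s - ψ k t|) (A : T → ℝ) {C : ℝ} (hA : ∀ t, |A t| ≤ C) :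
    (𝔼 ε : Fin N → ℤˣ, ⨆ t, (A t + ∑ k, ((ε k : ℤ) : ℝ) * φ k t)) ≤
      𝔼 ε : Fin N → ℤˣ, ⨆ t, (A t + ∑ k, ((ε k : ℤ) : ℝ) * ψ k t) := by
  induction N generalizing A C with
  | zero => simp
  | succ N ih =>
    rw [expect_fin_succ, expect_fin_succ]
    simp only [Fin.sum_univ_succ, Fin.cons_zero, Fin.cons_succ]
    calc (𝔼 e : ℤˣ, 𝔼 y : Fin N → ℤˣ,
          ⨆ t, (A t + (((e : ℤ) : ℝ) * φ 0 t + ∑ k, ((y k : ℤ) : ℝ) * φ k.succ t)))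
        ≤ 𝔼 e : ℤˣ, 𝔼 y : Fin N → ℤˣ,
          ⨆ t, (A t + (((e : ℤ) : ℝ) * φ 0 t + ∑ k, ((y k : ℤ) : ℝ) * ψ k.succ t)) := by
          refine Finset.expect_le_expect fun e _ => ?_
          simp only [← add_assoc]
          -- The offset `A` is general so that the first term can be absorbed into it while the tail
          -- is replaced.
          refine ih (fun k => φ k.succ) (fun k => ψ k.succ) (fun k => hφ _) (fun k => hψ _)
            (fun k => h _) (fun t => A t + ((e : ℤ) : ℝ) * φ 0 t) (C := C + D) fun t => ?_
          refine (abs_add_le _ _).trans (add_le_add (hA t) ?_)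
          rw [abs_sign_mul]
          exact hφ 0 t
      _ = 𝔼 y : Fin N → ℤˣ, 𝔼 e : ℤˣ,
          ⨆ t, (A t + (((e : ℤ) : ℝ) * φ 0 t + ∑ k, ((y k : ℤ) : ℝ) * ψ k.succ t)) :=
          Finset.expect_comm _ _ _
      _ ≤ 𝔼 y : Fin N → ℤˣ, 𝔼 e : ℤˣ,
          ⨆ t, (A t + (((e : ℤ) : ℝ) * ψ 0 t + ∑ k, ((y k : ℤ) : ℝ) * ψ k.succ t)) := by
          refine Finset.expect_le_expect fun y _ => ?_
          rw [expect_sign, expect_sign]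
          have key := ciSup_add_ciSup_sub_le
            (A := fun t => A t + ∑ k, ((y k : ℤ) : ℝ) * ψ k.succ t) (φ := φ 0) (ψ := ψ 0)
            (C := C + N * D) (D := D)
            (fun t => (abs_add_le _ _).trans (add_le_add (hA t) (abs_sum_le_of_abs_le fun k => by
              rw [abs_sign_mul]; exact hψ _ t))) (hψ 0) (h 0)
          have e1 : ∀ χ : T → ℝ,
              (⨆ t, (A t + ((((1 : ℤˣ) : ℤ) : ℝ) * χ t + ∑ k, ((y k : ℤ) : ℝ) * ψ k.succ t))) =
                ⨆ t, (A t + ∑ k, ((y k : ℤ) : ℝ) * ψ k.succ t + χ t) := fun χ =>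
            iSup_congr fun t => by push_cast; ring
          have e2 : ∀ χ : T → ℝ,
              (⨆ t, (A t + ((((-1 : ℤˣ) : ℤ) : ℝ) * χ t + ∑ k, ((y k : ℤ) : ℝ) * ψ k.succ t))) =
                ⨆ t, (A t + ∑ k, ((y k : ℤ) : ℝ) * ψ k.succ t - χ t) := fun χ =>
            iSup_congr fun t => by push_cast; ring
          rw [e1, e2, e1, e2]
          linarith
      _ = _ := Finset.expect_comm _ _ _

/-- Symmetrization: the expected one-sided deviation of an empirical process from its mean is at
most twice its Rademacher average. -/
theorem expect_ciSup_sub_le {ι : Type*} [Fintype ι] [Nonempty ι] [Nonempty T] {N : ℕ}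
    (f : T → ι → ℝ) {D : ℝ} (hD : ∀ t i, |f t i| ≤ D) :
    (𝔼 ω : Fin N → ι, ⨆ t, (N * (𝔼 i, f t i) - ∑ k, f t (ω k))) ≤
      2 * 𝔼 ω : Fin N → ι, 𝔼 ε : Fin N → ℤˣ, ⨆ t, ∑ k, ((ε k : ℤ) : ℝ) * f t (ω k) := by
  have bsum : ∀ (ω : Fin N → ι) (ε : Fin N → ℤˣ) (t : T),
      |∑ k, ((ε k : ℤ) : ℝ) * f t (ω k)| ≤ N * D := fun ω ε t =>
    abs_sum_le_of_abs_le fun k => by rw [abs_sign_mul]; exact hD _ _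
  have bdiff : ∀ (ω ω' : Fin N → ι) (ε : Fin N → ℤˣ) (t : T),
      |∑ k, ((ε k : ℤ) : ℝ) * (f t (ω' k) - f t (ω k))| ≤ N * (D + D) := fun ω ω' ε t =>
    abs_sum_le_of_abs_le fun k => by
      rw [abs_sign_mul]; exact (abs_sub _ _).trans (add_le_add (hD _ _) (hD _ _))
  set H : (Fin N → ι) → (Fin N → ι) → (Fin N → ℤˣ) → ℝ := fun ω ω' ε =>
    ⨆ t, ∑ k, ((ε k : ℤ) : ℝ) * (f t (ω' k) - f t (ω k)) with hH
  -- The mean is rewritten as an average over an independent copy `ω'`, which is then pulled out of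
  -- the supremum.
  have ghost : (𝔼 ω : Fin N → ι, ⨆ t, (N * (𝔼 i, f t i) - ∑ k, f t (ω k))) ≤
      𝔼 ω : Fin N → ι, 𝔼 ω' : Fin N → ι, H ω ω' 1 := by
    refine Finset.expect_le_expect fun ω _ => ciSup_le fun t => ?_
    have : N * (𝔼 i, f t i) - ∑ k, f t (ω k) =
        𝔼 ω' : Fin N → ι, ∑ k, (((1 : ℤˣ) : ℤ) : ℝ) * (f t (ω' k) - f t (ω k)) := by
      rw [Finset.expect_sum_comm]
      simp only [Units.val_one, Int.cast_one, one_mul, Finset.expect_sub_distrib, expect_coord,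
        Fintype.expect_const, Finset.sum_sub_distrib, Finset.sum_const, Finset.card_univ,
        Fintype.card_fin, nsmul_eq_mul]
    rw [this]
    exact Finset.expect_le_expect fun ω' _ =>
      le_ciSup (f := fun t => ∑ k, (((1 : ℤˣ) : ℤ) : ℝ) * (f t (ω' k) - f t (ω k)))
        (bddAbove_of_abs_le (bdiff ω ω' 1)) t
  have sign_swap : ∀ ε : Fin N → ℤˣ, (𝔼 ω : Fin N → ι, 𝔼 ω' : Fin N → ι, H ω ω' 1) =
      𝔼 ω : Fin N → ι, 𝔼 ω' : Fin N → ι, H ω ω' ε := fun ε => by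
    have pairs : ∀ F : (Fin N → ι) → (Fin N → ι) → ℝ, (𝔼 ω, 𝔼 ω', F ω ω') =
        𝔼 w : Fin N → ι × ι, F (fun k => (w k).1) (fun k => (w k).2) := fun F => by
      rw [Fintype.expect_equiv (Equiv.arrowProdEquivProdArrow (Fin N) (fun _ => ι) (fun _ => ι))
        (fun w => F (fun k => (w k).1) (fun k => (w k).2)) (fun p => F p.1 p.2) (fun w => rfl),
        ← Finset.univ_product_univ, Finset.expect_product]
    rw [pairs, pairs]
    -- Exchanging `ω k` and `ω' k` exactly where `ε k = -1` preserves the uniform law and flips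
    -- those differences.
    refine Fintype.expect_equiv
      (Equiv.piCongrRight fun k => if ε k = 1 then Equiv.refl (ι × ι) else Equiv.prodComm ι ι)
      _ _ fun w => iSup_congr fun t => Finset.sum_congr rfl fun k _ => ?_
    rcases Int.units_eq_one_or (ε k) with he | he <;> simp [he]
  have average_signs : (𝔼 ω : Fin N → ι, 𝔼 ω' : Fin N → ι, H ω ω' 1) =
      𝔼 ε : Fin N → ℤˣ, 𝔼 ω : Fin N → ι, 𝔼 ω' : Fin N → ι, H ω ω' ε := by
    rw [← Finset.expect_congr rfl fun ε _ => sign_swap ε, Fintype.expect_const]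
  set S : (Fin N → ι) → (Fin N → ℤˣ) → ℝ := fun ω ε =>
    ⨆ t, ∑ k, ((ε k : ℤ) : ℝ) * f t (ω k) with hS
  have split_sup : ∀ ω ω' ε, H ω ω' ε ≤ S ω' ε + S ω (-ε) := fun ω ω' ε => by
    refine ciSup_le fun t => ?_
    have h1 : ∑ k, ((ε k : ℤ) : ℝ) * f t (ω' k) ≤ S ω' ε :=
      le_ciSup (f := fun t => ∑ k, ((ε k : ℤ) : ℝ) * f t (ω' k))
        (bddAbove_of_abs_le (bsum ω' ε)) t
    have h2 : ∑ k, (((-ε) k : ℤ) : ℝ) * f t (ω k) ≤ S ω (-ε) :=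
      le_ciSup (f := fun t => ∑ k, (((-ε) k : ℤ) : ℝ) * f t (ω k))
        (bddAbove_of_abs_le (bsum ω (-ε))) t
    refine le_trans (le_of_eq ?_) (add_le_add h1 h2)
    rw [← Finset.sum_add_distrib]
    refine Finset.sum_congr rfl fun k _ => ?_
    simp only [Pi.neg_apply, Units.val_neg, Int.cast_neg]
    ring
  have neg_signs : ∀ ω, (𝔼 ε, S ω (-ε)) = 𝔼 ε, S ω ε := fun ω =>
    Fintype.expect_equiv (Equiv.neg _) _ _ fun ε => rfl
  calc _ ≤ 𝔼 ε : Fin N → ℤˣ, 𝔼 ω : Fin N → ι, 𝔼 ω' : Fin N → ι, H ω ω' ε :=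
        ghost.trans average_signs.le
    _ ≤ 𝔼 ε : Fin N → ℤˣ, 𝔼 ω : Fin N → ι, 𝔼 ω' : Fin N → ι, (S ω' ε + S ω (-ε)) :=
        Finset.expect_le_expect fun ε _ => Finset.expect_le_expect fun ω _ =>
          Finset.expect_le_expect fun ω' _ => split_sup ω ω' ε
    _ = (𝔼 ε, 𝔼 ω, S ω ε) + 𝔼 ε, 𝔼 ω, S ω (-ε) := by
        simp only [Finset.expect_add_distrib, Fintype.expect_const]
    _ = 2 * 𝔼 ω, 𝔼 ε, S ω ε := by
        rw [Finset.expect_comm, Finset.expect_comm (f := fun ε ω => S ω (-ε))]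
        simp only [neg_signs]
        ring

end Suprema

/-! ### Euclidean geometry of matrices. -/

section FrobeniusSpace

variable {m n : ℕ}

/-- Matrices as vectors of a Euclidean space. -/
def toEuclid : Mat m n ≃ₗ[ℝ] EuclideanSpace ℝ (Fin m × Fin n) where
  toFun A := WithLp.toLp 2 fun p => A p.1 p.2
  invFun v := Matrix.of fun i j => v (i, j)
  map_add' A B := by ext p; simp
  map_smul' c A := by ext p; simp
  left_inv A := by ext i j; simp
  right_inv v := by ext p; simp

theorem inner_toEuclid (A B : Mat m n) :
    inner ℝ (toEuclid A) (toEuclid B) = frobInner A B := by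
  simp only [toEuclid, frobInner, LinearEquiv.coe_mk, LinearMap.coe_mk, AddHom.coe_mk,
    PiLp.inner_apply, Fintype.sum_prod_type]
  refine Finset.sum_congr rfl fun i _ => Finset.sum_congr rfl fun j _ => ?_
  simp [mul_comm]

theorem norm_toEuclid (A : Mat m n) : ‖toEuclid A‖ = frobNorm A := by
  rw [frobNorm, ← inner_toEuclid, real_inner_self_eq_norm_sq, Real.sqrt_sq (norm_nonneg _)]

theorem frobNorm_nonneg (A : Mat m n) : 0 ≤ frobNorm A := Real.sqrt_nonneg _

theorem frobNorm_eq_zero {A : Mat m n} : frobNorm A = 0 ↔ A = 0 := by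
  rw [← norm_toEuclid, norm_eq_zero, LinearEquiv.map_eq_zero_iff]

theorem frobNorm_pos {A : Mat m n} (h : A ≠ 0) : 0 < frobNorm A :=
  (frobNorm_nonneg A).lt_of_ne fun h' => h (frobNorm_eq_zero.1 h'.symm)

theorem frobNorm_smul (c : ℝ) (A : Mat m n) : frobNorm (c • A) = |c| * frobNorm A := by
  rw [← norm_toEuclid, map_smul, norm_smul, norm_toEuclid, Real.norm_eq_abs]

theorem frobNorm_sq (A : Mat m n) : frobNorm A ^ 2 = ∑ p : Fin m × Fin n, A p.1 p.2 ^ 2 := by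
  rw [← norm_toEuclid, ← real_inner_self_eq_norm_sq, inner_toEuclid, frobInner,
    Fintype.sum_prod_type]
  simp only [pow_two]

theorem abs_entry_le_frobNorm (A : Mat m n) (i : Fin m) (j : Fin n) : |A i j| ≤ frobNorm A := by
  have h := PiLp.norm_apply_le (p := 2) (toEuclid A) (i, j)
  rw [norm_toEuclid] at h
  exact h

theorem frobInner_smul_left (c : ℝ) (A B : Mat m n) :
    frobInner (c • A) B = c * frobInner A B := by
  simp only [← inner_toEuclid, map_smul, real_inner_smul_left]

theorem frobInner_sum_single {N : ℕ} (Om : Fin N → Fin m × Fin n) (x : Fin N → ℝ) (A : Mat m n) :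
    frobInner A (∑ k, Matrix.single (Om k).1 (Om k).2 (x k)) =
      ∑ k, A (Om k).1 (Om k).2 * x k := by
  rw [← inner_toEuclid, map_sum, inner_sum]
  refine Finset.sum_congr rfl fun k _ => ?_
  rw [inner_toEuclid, frobInner, Finset.sum_eq_single (Om k).1, Finset.sum_eq_single (Om k).2]
  · simp
  · intro j _ hj; simp [Ne.symm hj]
  · simp
  · intro i _ hi; simp [Ne.symm hi]
  · simp

theorem abs_entry_le_maxNorm (A : Mat m n) (p : Fin m × Fin n) : |A p.1 p.2| ≤ maxNorm A :=
  le_ciSup (f := fun p : Fin m × Fin n => |A p.1 p.2|) (Set.finite_range _).bddAbove p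

/-- Orthogonal splitting of a matrix along a subspace. -/
theorem exists_orthogonal_decomposition (V : Submodule ℝ (Mat m n)) (A : Mat m n) :
    ∃ U ∈ V, ∃ W : Mat m n, A = U + W ∧ (∀ C ∈ V, frobInner C W = 0) ∧
      frobNorm U ≤ frobNorm A := by
  set V' : Submodule ℝ (EuclideanSpace ℝ (Fin m × Fin n)) :=
    V.map (toEuclid (m := m) (n := n)).toLinearMap
  refine ⟨toEuclid.symm (V'.starProjection (toEuclid A)), ?_,
    A - toEuclid.symm (V'.starProjection (toEuclid A)), by abel, fun C hC => ?_, ?_⟩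
  · obtain ⟨U, hU, h⟩ := Submodule.mem_map.1 (V'.starProjection_apply_mem (toEuclid A))
    rw [← h]
    simpa using hU
  · rw [← inner_toEuclid, map_sub, LinearEquiv.apply_symm_apply]
    have hm : toEuclid C ∈ V' := Submodule.mem_map_of_mem hC
    exact V'.sub_starProjection_mem_orthogonal (toEuclid A) _ hm
  · rw [← norm_toEuclid, ← norm_toEuclid A, LinearEquiv.apply_symm_apply]
    exact V'.norm_starProjection_apply_le _

end FrobeniusSpace

/-! ### Norm comparison, duality and decomposability. -/

section Regularizer

variable {m n : ℕ} (R : Seminorm ℝ (Mat m n))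

theorem exists_le_mul_frobNorm : ∃ C, 0 ≤ C ∧ ∀ A, R A ≤ C * frobNorm A := by
  refine ⟨∑ i, ∑ j, R (Matrix.single i j 1), by positivity, fun A => ?_⟩
  have hsub : ∀ {ι : Type} (s : Finset ι) (f : ι → Mat m n), R (∑ i ∈ s, f i) ≤ ∑ i ∈ s, R (f i) :=
    fun s f => Finset.le_sum_of_subadditive R (map_zero R).le (map_add_le_add R) s f
  calc R A = R (∑ i, ∑ j, Matrix.single i j (A i j)) := by rw [← Matrix.matrix_eq_sum_single]
    _ ≤ ∑ i, ∑ j, R (Matrix.single i j (A i j)) :=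
        (hsub _ _).trans (Finset.sum_le_sum fun i _ => hsub _ _)
    _ ≤ ∑ i, ∑ j, R (Matrix.single i j 1) * frobNorm A := by
        refine Finset.sum_le_sum fun i _ => Finset.sum_le_sum fun j _ => ?_
        have : Matrix.single i j (A i j) = A i j • Matrix.single i j (1 : ℝ) := by
          simp [Matrix.smul_single]
        rw [this, map_smul_eq_mul, mul_comm, Real.norm_eq_abs]
        exact mul_le_mul_of_nonneg_left (abs_entry_le_frobNorm A i j) (apply_nonneg R _)
    _ = _ := by simp only [Finset.sum_mul]

theorem bddAbove_compat (V : Submodule ℝ (Mat m n)) :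
    BddAbove {x | ∃ A ∈ V, A ≠ 0 ∧ x = R A / frobNorm A} := by
  obtain ⟨C, -, hC⟩ := exists_le_mul_frobNorm R
  refine ⟨C, ?_⟩
  rintro _ ⟨A, -, hA, rfl⟩
  exact (div_le_iff₀ (frobNorm_pos hA)).2 (hC A)

theorem le_psiMax_mul {V : Submodule ℝ (Mat m n)} {A : Mat m n} (hA : A ∈ V) :
    R A ≤ psiMax R V * frobNorm A := by
  by_cases h : A = 0
  · simp [h, frobNorm_eq_zero.2 rfl]
  · exact (div_le_iff₀ (frobNorm_pos h)).1 (le_csSup (bddAbove_compat R V) ⟨A, hA, h, rfl⟩)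

theorem psiMin_nonneg : 0 ≤ psiMin R := by
  refine Real.sInf_nonneg ?_
  rintro _ ⟨A, -, rfl⟩
  exact div_nonneg (apply_nonneg R A) (frobNorm_nonneg A)

variable {R}

theorem psiMax_pos (hR : IsNorm R) {V : Submodule ℝ (Mat m n)} (hV : V ≠ ⊥) : 0 < psiMax R V := by
  obtain ⟨A, hA, h⟩ := V.ne_bot_iff.1 hV
  have h1 : 0 < R A := (apply_nonneg R A).lt_of_ne fun h' => h (hR A h'.symm)
  exact (div_pos h1 (frobNorm_pos h)).trans_le
    (le_csSup (bddAbove_compat R V) ⟨A, hA, h, rfl⟩)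

theorem psiMin_le_psiMax {V : Submodule ℝ (Mat m n)} (hV : V ≠ ⊥) : psiMin R ≤ psiMax R V := by
  obtain ⟨A, hA, h⟩ := V.ne_bot_iff.1 hV
  have hb : BddBelow {x | ∃ A : Mat m n, A ≠ 0 ∧ x = R A / frobNorm A} := by
    refine ⟨0, ?_⟩
    rintro _ ⟨B, -, rfl⟩
    exact div_nonneg (apply_nonneg R B) (frobNorm_nonneg B)
  exact (csInf_le hb ⟨A, h, rfl⟩).trans (le_csSup (bddAbove_compat R V) ⟨A, hA, h, rfl⟩)

/-- Compactness of the unit sphere gives `R` a positive minimum there. This keeps the set defining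
`dualNorm` bounded, so that its `sSup` is a genuine supremum and not the default `0`. -/
theorem IsNorm.exists_frobNorm_le (hR : IsNorm R) : ∃ C, 0 ≤ C ∧ ∀ A, frobNorm A ≤ C * R A := by
  set E := EuclideanSpace ℝ (Fin m × Fin n)
  obtain ⟨C, hC, hCR⟩ := exists_le_mul_frobNorm R
  set q : Seminorm ℝ E := R.comp (toEuclid (m := m) (n := n)).symm.toLinearMap with hq
  have hqv : ∀ v, q v = R (toEuclid.symm v) := fun v => rfl
  have hcont : Continuous q := by
    refine Seminorm.continuous_of_le (q := C.toNNReal • normSeminorm ℝ E) ?_ fun v => ?_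
    · exact (continuous_norm).const_smul C.toNNReal
    · have := hCR (toEuclid.symm v)
      rw [← norm_toEuclid, LinearEquiv.apply_symm_apply] at this
      simpa [hqv, NNReal.smul_def, Real.coe_toNNReal C hC] using this
  by_cases hne : (Metric.sphere (0 : E) 1).Nonempty
  · obtain ⟨v, hv, hmin⟩ := (isCompact_sphere (0 : E) 1).exists_isMinOn hne hcont.continuousOn
    have hv1 : ‖v‖ = 1 := by simpa using hv
    have hpos : 0 < q v := by
      refine (apply_nonneg q v).lt_of_ne fun h' => ?_
      have h0 := hR _ ((hqv v).symm.trans h'.symm)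
      rw [LinearEquiv.map_eq_zero_iff] at h0
      simp [h0] at hv1
    refine ⟨(q v)⁻¹, (inv_pos.2 hpos).le, fun A => ?_⟩
    by_cases hA : A = 0
    · simp [hA, frobNorm_eq_zero.2 rfl]
    have hf := frobNorm_pos hA
    have hmem : (frobNorm A)⁻¹ • toEuclid A ∈ Metric.sphere (0 : E) 1 := by
      rw [mem_sphere_zero_iff_norm, norm_smul, norm_toEuclid, norm_inv, Real.norm_eq_abs,
        abs_of_pos hf, inv_mul_cancel₀ hf.ne']
    have h1 : q v ≤ q ((frobNorm A)⁻¹ • toEuclid A) := hmin hmem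
    rw [map_smul_eq_mul, hqv (toEuclid A), LinearEquiv.symm_apply_apply, norm_inv,
      Real.norm_eq_abs, abs_of_pos hf, ← div_eq_inv_mul, le_div_iff₀ hf] at h1
    rwa [← div_eq_inv_mul, le_div_iff₀ hpos, mul_comm]
  -- An empty sphere means a zero space, since a nonzero matrix could be normalized onto it.
  · refine ⟨0, le_rfl, fun A => ?_⟩
    by_contra hA
    rw [zero_mul, not_le] at hA
    refine hne ⟨(frobNorm A)⁻¹ • toEuclid A, ?_⟩
    rw [mem_sphere_zero_iff_norm, norm_smul, norm_toEuclid, norm_inv, Real.norm_eq_abs,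
      abs_of_pos hA, inv_mul_cancel₀ hA.ne']

theorem IsNorm.bddAbove_dualNorm (hR : IsNorm R) (A : Mat m n) :
    BddAbove {x | ∃ B : Mat m n, R B ≤ 1 ∧ x = frobInner B A} := by
  obtain ⟨C, hC, hCR⟩ := hR.exists_frobNorm_le
  refine ⟨C * frobNorm A, ?_⟩
  rintro _ ⟨B, hB, rfl⟩
  rw [← inner_toEuclid]
  refine (real_inner_le_norm _ _).trans ?_
  rw [norm_toEuclid, norm_toEuclid]
  exact mul_le_mul_of_nonneg_right ((hCR B).trans (mul_le_of_le_one_right hC hB))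
    (frobNorm_nonneg A)

theorem IsNorm.dualNorm_nonneg (hR : IsNorm R) (A : Mat m n) : 0 ≤ dualNorm R A :=
  le_csSup (hR.bddAbove_dualNorm A) ⟨0, by simp, by simp [frobInner]⟩

theorem IsNorm.frobInner_le (hR : IsNorm R) (A B : Mat m n) :
    frobInner B A ≤ R B * dualNorm R A := by
  by_cases h : B = 0
  · simp [h, frobInner]
  have hB : 0 < R B := (apply_nonneg R B).lt_of_ne fun h' => h (hR B h'.symm)
  have h1 : frobInner ((R B)⁻¹ • B) A ≤ dualNorm R A :=
    le_csSup (hR.bddAbove_dualNorm A) ⟨(R B)⁻¹ • B, by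
      rw [map_smul_eq_mul, norm_inv, Real.norm_eq_abs, abs_of_pos hB, inv_mul_cancel₀ hB.ne'], rfl⟩
  rwa [frobInner_smul_left, ← div_eq_inv_mul, div_le_iff₀ hB, mul_comm] at h1

theorem IsNorm.kappa_nonneg (hR : IsNorm R) (N : ℕ) : 0 ≤ kappa R N :=
  Finset.expect_nonneg fun _ _ => Finset.expect_nonneg fun _ _ =>
    mul_nonneg (by positivity) (hR.dualNorm_nonneg _)

/-- A perturbation whose regularizer cost exceeds the decrease by at most half its norm is dominated
by its component in the model subspace. -/
theorem le_four_psiMax_mul {M V : Submodule ℝ (Mat m n)} (hdec : IsDecomposable R M V)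
    {A D : Mat m n} (hA : A ∈ M) (h : R (A + D) ≤ R A + R D / 2) :
    R D ≤ 4 * psiMax R V * frobNorm D := by
  obtain ⟨U, hU, W, rfl, hW, hUD⟩ := exists_orthogonal_decomposition V D
  have h1 := hdec A hA W hW
  have h2 : R (A + W) ≤ R (A + (U + W)) + R U := by
    have := map_sub_le_add R (A + (U + W)) U
    rwa [show A + (U + W) - U = A + W by abel] at this
  have h3 := map_add_le_add R U W
  have h4 := le_psiMax_mul R hU
  have hΨ : 0 ≤ psiMax R V := by
    refine Real.sSup_nonneg ?_
    rintro _ ⟨B, -, -, rfl⟩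
    exact div_nonneg (apply_nonneg R B) (frobNorm_nonneg B)
  have h5 := mul_le_mul_of_nonneg_left hUD hΨ
  -- The above give `R W ≤ R U + R D / 2` for `D = U + W`, hence `R D ≤ 2 R U + R D / 2` and `R D ≤
  -- 4 R U`.
  nlinarith

end Regularizer

/-! ### Bregman curvature and the cone condition for the error. -/

theorem bregman_lower_bound {G : ℝ → ℝ} (hG : AnalyticOnNhd ℝ G Set.univ) {c r : ℝ}
    (hc : ∀ u, |u| ≤ r → c ≤ deriv (deriv G) u) {x y : ℝ} (hx : |x| ≤ r) (hy : |y| ≤ r) :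
    c / 2 * (x - y) ^ 2 ≤ bregman G x y := by
  by_cases hxy : y = x
  · simp [hxy, bregman]
  have hcd : ContDiff ℝ 2 G := contDiffOn_univ.1 (hG.contDiffOn uniqueDiffOn_univ)
  -- The Lagrange point lies between `y` and `x`, hence within the range `r` where the curvature
  -- bound holds.
  obtain ⟨z, hz, h⟩ := taylor_mean_remainder_lagrange_iteratedDeriv (n := 1) hxy hcd.contDiffOn
  have hzr : |z| ≤ r := by
    obtain ⟨h1, h2⟩ := hz
    rw [abs_le] at *
    exact ⟨(le_inf hy.1 hx.1).trans h1.le, h2.le.trans (sup_le hy.2 hx.2)⟩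
  have hd : derivWithin G (Set.uIcc y x) y = deriv G y :=
    (hcd.differentiable (by norm_num) y).derivWithin
      ((uniqueDiffOn_uIcc hxy) y Set.left_mem_uIcc)
  have h2 : iteratedDeriv (1 + 1) G z = deriv (deriv G) z := by
    rw [iteratedDeriv_succ, iteratedDeriv_one]
  rw [h2] at h
  simp only [taylorWithinEval_succ, taylor_within_zero_eval] at h
  norm_num [hd] at h
  have h3 := mul_le_mul_of_nonneg_right (hc z hzr) (sq_nonneg (x - y))
  rw [bregman]
  linarith

/-- The excess of the empirical risk over its linearization is a sum of Bregman divergences. -/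
theorem sum_bregman_eq {m n N : ℕ} (G : ℝ → ℝ) (Om : Fin N → Fin m × Fin n) (X Θ Θ' : Mat m n) :
    ∑ k, bregman G (Θ (Om k).1 (Om k).2) (Θ' (Om k).1 (Om k).2) =
      ∑ k, (G (Θ (Om k).1 (Om k).2) - X (Om k).1 (Om k).2 * Θ (Om k).1 (Om k).2) -
      ∑ k, (G (Θ' (Om k).1 (Om k).2) - X (Om k).1 (Om k).2 * Θ' (Om k).1 (Om k).2) +
      frobInner (Θ - Θ') (proj Om (Matrix.of fun i j => X i j - deriv G (Θ' i j))) := by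
  rw [proj, frobInner_sum_single, ← Finset.sum_sub_distrib, ← Finset.sum_add_distrib]
  refine Finset.sum_congr rfl fun k _ => ?_
  simp only [bregman, Matrix.sub_apply, Matrix.of_apply]
  ring

/-- The error of the regularized estimate lies in a cone on which the regularizer is controlled by
the Frobenius norm. -/
theorem IsEstimate.regularizer_error_le {m n N : ℕ} {G : ℝ → ℝ} {R : Seminorm ℝ (Mat m n)}
    (hR : IsNorm R) {M V : Submodule ℝ (Mat m n)} (hdec : IsDecomposable R M V)
    {lam α : ℝ} (hlam : 0 < lam) {Om : Fin N → Fin m × Fin n} {X Θ Θ' : Mat m n}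
    (hΘ' : Θ' ∈ M) (hmax : maxNorm Θ' ≤ α / Real.sqrt ((m : ℝ) * n))
    (hΘ : IsEstimate G R lam α Om X Θ)
    (hdual : (m : ℝ) * n / N *
      dualNorm R (proj Om (Matrix.of fun i j => X i j - deriv G (Θ' i j))) ≤ lam / 2)
    (hB : 0 ≤ ∑ k, bregman G (Θ (Om k).1 (Om k).2) (Θ' (Om k).1 (Om k).2)) :
    R (Θ - Θ') ≤ 4 * psiMax R V * frobNorm (Θ - Θ') := by
  refine le_four_psiMax_mul hdec hΘ' ?_
  rw [add_sub_cancel]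
  have hopt := hΘ.2 Θ' hmax
  simp only [objective] at hopt
  rw [sum_bregman_eq G Om X] at hB
  have hq : (0 : ℝ) ≤ (m : ℝ) * n / N := by positivity
  have h1 := mul_nonneg hq hB
  have h2 := mul_le_mul_of_nonneg_left (hR.frobInner_le
    (proj Om (Matrix.of fun i j => X i j - deriv G (Θ' i j))) (Θ - Θ')) hq
  have h3 := mul_le_mul_of_nonneg_left hdual (apply_nonneg R (Θ - Θ'))
  rw [mul_add, mul_sub] at h1
  have h4 : lam * R Θ ≤ lam * (R Θ' + R (Θ - Θ') / 2) := by nlinarith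
  exact le_of_mul_le_mul_left h4 hlam

/-! ### Uniform lower bound for sampled squared norms. -/

section SampledProcess

variable {m n N : ℕ} {R : Seminorm ℝ (Mat m n)} {ρ L : ℝ}

/-- The Lipschitz bound for the square on `[-b, b]`, in the form the contraction principle takes. -/
theorem abs_mul_sq_sub_le {c x y b : ℝ} (hc : 0 ≤ c) (hx : |x| ≤ b) (hy : |y| ≤ b) :
    |c * x ^ 2 - c * y ^ 2| ≤ |c * (2 * b) * x - c * (2 * b) * y| := by
  have hb : 0 ≤ b := (abs_nonneg x).trans hx
  rw [← mul_sub, ← mul_sub, abs_mul, abs_mul, abs_of_nonneg hc,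
    abs_of_nonneg (by positivity : 0 ≤ c * (2 * b)), sq_sub_sq, abs_mul, mul_assoc]
  refine mul_le_mul_of_nonneg_left (mul_le_mul_of_nonneg_right ?_ (abs_nonneg _)) hc
  exact (abs_add_le _ _).trans (by linarith)

/-- Matrices of unit Frobenius norm with bounded regularizer and bounded entries. -/
def unitSlice (R : Seminorm ℝ (Mat m n)) (ρ L : ℝ) : Set (Mat m n) :=
  {D | frobNorm D = 1 ∧ R D ≤ ρ ∧ ∀ p : Fin m × Fin n, |D p.1 p.2| ≤ L}

/-- The rescaled square of an entry. -/
def sqEntry (D : unitSlice R ρ L) (p : Fin m × Fin n) : ℝ :=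
  (m : ℝ) * n * (D : Mat m n) p.1 p.2 ^ 2

theorem sqEntry_nonneg (D : unitSlice R ρ L) (p : Fin m × Fin n) : 0 ≤ sqEntry D p := by
  unfold sqEntry; positivity

theorem sqEntry_le (D : unitSlice R ρ L) (p : Fin m × Fin n) :
    sqEntry D p ≤ (m : ℝ) * n * L ^ 2 :=
  mul_le_mul_of_nonneg_left (sq_le_sq.2 ((D.2.2.2 p).trans (le_abs_self L))) (by positivity)

theorem abs_sqEntry_le (D : unitSlice R ρ L) (p : Fin m × Fin n) :
    |sqEntry D p| ≤ (m : ℝ) * n * L ^ 2 := by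
  rw [abs_of_nonneg (sqEntry_nonneg D p)]
  exact sqEntry_le D p

theorem expect_sqEntry (hm : 0 < m) (hn : 0 < n) (D : unitSlice R ρ L) :
    𝔼 p, sqEntry D p = 1 := by
  have h := frobNorm_sq (D : Mat m n)
  rw [D.2.1, one_pow] at h
  have hm' : (m : ℝ) ≠ 0 := by exact_mod_cast hm.ne'
  have hn' : (n : ℝ) ≠ 0 := by exact_mod_cast hn.ne'
  simp only [sqEntry]
  rw [← Finset.mul_expect, Fintype.expect_eq_sum_div_card, ← h]
  simp only [Fintype.card_prod, Fintype.card_fin, Nat.cast_mul]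
  field_simp

/-- The largest deficit of the sampled squared norm over the slice. -/
noncomputable def maxDeficit (R : Seminorm ℝ (Mat m n)) (ρ L : ℝ)
    (Om : Fin N → Fin m × Fin n) : ℝ :=
  ⨆ D : unitSlice R ρ L, (N * (𝔼 p, sqEntry D p) - ∑ k, sqEntry D (Om k))

theorem bddAbove_deficit (hm : 0 < m) (hn : 0 < n) (Om : Fin N → Fin m × Fin n) :
    BddAbove (Set.range fun D : unitSlice R ρ L =>
      (N * (𝔼 p, sqEntry D p) - ∑ k, sqEntry D (Om k))) := by
  refine ⟨N, ?_⟩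
  rintro _ ⟨D, rfl⟩
  have := Finset.sum_nonneg fun k (_ : k ∈ Finset.univ) => sqEntry_nonneg D (Om k)
  simp only [expect_sqEntry hm hn]
  linarith

theorem abs_maxDeficit_sub_update_le (hm : 0 < m) (hn : 0 < n) [Nonempty (unitSlice R ρ L)]
    (Om : Fin N → Fin m × Fin n) (k : Fin N) (p : Fin m × Fin n) :
    |maxDeficit R ρ L Om - maxDeficit R ρ L (Function.update Om k p)| ≤ (m : ℝ) * n * L ^ 2 := by
  have key : ∀ D : unitSlice R ρ L,
      ∑ j, sqEntry D (Om j) - ∑ j, sqEntry D (Function.update Om k p j) =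
        sqEntry D (Om k) - sqEntry D p := fun D => by
    rw [← Finset.sum_sub_distrib, Finset.sum_eq_single k]
    · simp
    · intro j _ hj; simp [hj]
    · simp
  rw [abs_sub_le_iff]
  constructor
  · rw [sub_le_iff_le_add']
    refine ciSup_le fun D => ?_
    have h1 := le_ciSup (bddAbove_deficit hm hn (Function.update Om k p)) D
    have h2 := key D
    have h3 := sqEntry_nonneg D (Om k)
    have h4 := sqEntry_le D p
    simp only [maxDeficit] at h1 ⊢
    linarith
  · rw [sub_le_iff_le_add']
    refine ciSup_le fun D => ?_
    have h1 := le_ciSup (bddAbove_deficit hm hn Om) D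
    have h2 := key D
    have h3 := sqEntry_nonneg D p
    have h4 := sqEntry_le D (Om k)
    simp only [maxDeficit] at h1 ⊢
    linarith

/-- Symmetrization gives a factor `2` and the Lipschitz constant of the square another `2 L`;
pairing `D` with the random sign matrix costs `R D ≤ ρ` times its dual norm. One factor `√(mn)` goes
into `kappa`, the other stays. -/
theorem expect_maxDeficit_le (hR : IsNorm R) (hm : 0 < m) (hn : 0 < n) (hN : 0 < N)
    [Nonempty (unitSlice R ρ L)] (hL : 0 ≤ L) :
    (𝔼 Om : Fin N → Fin m × Fin n, maxDeficit R ρ L Om) ≤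
      4 * Real.sqrt ((m : ℝ) * n) * L * ρ * N * kappa R N := by
  have : Nonempty (Fin m × Fin n) := ⟨(⟨0, hm⟩, ⟨0, hn⟩)⟩
  have hmn : (0 : ℝ) ≤ (m : ℝ) * n := by positivity
  have hN' : (N : ℝ) ≠ 0 := by exact_mod_cast hN.ne'
  have contract : ∀ Om : Fin N → Fin m × Fin n,
      (𝔼 ε : Fin N → ℤˣ, ⨆ D : unitSlice R ρ L, ∑ k, ((ε k : ℤ) : ℝ) * sqEntry D (Om k)) ≤
      𝔼 ε : Fin N → ℤˣ, ⨆ D : unitSlice R ρ L, ∑ k, ((ε k : ℤ) : ℝ) *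
        ((m : ℝ) * n * (2 * L) * (D : Mat m n) (Om k).1 (Om k).2) := fun Om => by
    have h := expect_ciSup_sign_sum_le (D := 2 * ((m : ℝ) * n * L ^ 2))
      (fun k (D : unitSlice R ρ L) => sqEntry D (Om k))
      (fun k D => (m : ℝ) * n * (2 * L) * (D : Mat m n) (Om k).1 (Om k).2)
      (fun k D => (abs_sqEntry_le D _).trans (by nlinarith [mul_nonneg hmn (sq_nonneg L)]))
      (fun k D => by
        rw [abs_mul, abs_of_nonneg (by positivity : 0 ≤ (m : ℝ) * n * (2 * L))]
        calc _ ≤ (m : ℝ) * n * (2 * L) * L :=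
              mul_le_mul_of_nonneg_left (D.2.2.2 (Om k)) (by positivity)
          _ = _ := by ring)
      (fun k D E => by
        have hD := D.2.2.2 (Om k)
        have hE := E.2.2.2 (Om k)
        exact abs_mul_sq_sub_le hmn hD hE)
      (fun _ => 0) (C := 0) (by simp)
    simpa using h
  have dual : ∀ (Om : Fin N → Fin m × Fin n) (ε : Fin N → ℤˣ),
      (⨆ D : unitSlice R ρ L, ∑ k, ((ε k : ℤ) : ℝ) *
        ((m : ℝ) * n * (2 * L) * (D : Mat m n) (Om k).1 (Om k).2)) ≤
      2 * Real.sqrt ((m : ℝ) * n) * L * ρ * N * (Real.sqrt ((m : ℝ) * n) / N *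
        dualNorm R (∑ k, Matrix.single (Om k).1 (Om k).2 (((ε k : ℤˣ) : ℤ) : ℝ))) :=
    fun Om ε => ciSup_le fun D => by
      set Q := dualNorm R (∑ k, Matrix.single (Om k).1 (Om k).2 (((ε k : ℤˣ) : ℤ) : ℝ)) with hQ
      have h1 : frobInner (D : Mat m n)
          (∑ k, Matrix.single (Om k).1 (Om k).2 (((ε k : ℤˣ) : ℤ) : ℝ)) ≤ ρ * Q :=
        (hR.frobInner_le _ _).trans
          (mul_le_mul_of_nonneg_right D.2.2.1 (hR.dualNorm_nonneg _))
      rw [frobInner_sum_single] at h1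
      calc ∑ k, ((ε k : ℤ) : ℝ) * ((m : ℝ) * n * (2 * L) * (D : Mat m n) (Om k).1 (Om k).2)
          = (m : ℝ) * n * (2 * L) * ∑ k, (D : Mat m n) (Om k).1 (Om k).2 * ((ε k : ℤ) : ℝ) := by
            rw [Finset.mul_sum]
            exact Finset.sum_congr rfl fun k _ => by ring
        _ ≤ (m : ℝ) * n * (2 * L) * (ρ * Q) := mul_le_mul_of_nonneg_left h1 (by positivity)
        _ = (Real.sqrt ((m : ℝ) * n) * Real.sqrt ((m : ℝ) * n)) * (2 * L) * (ρ * Q) := by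
            rw [Real.mul_self_sqrt hmn]
        _ = _ := by field_simp
  calc (𝔼 Om : Fin N → Fin m × Fin n, maxDeficit R ρ L Om)
      ≤ 2 * 𝔼 Om : Fin N → Fin m × Fin n, 𝔼 ε : Fin N → ℤˣ,
        ⨆ D : unitSlice R ρ L, ∑ k, ((ε k : ℤ) : ℝ) * sqEntry D (Om k) :=
        expect_ciSup_sub_le sqEntry abs_sqEntry_le
    _ ≤ 2 * 𝔼 Om : Fin N → Fin m × Fin n, 𝔼 ε : Fin N → ℤˣ,
        2 * Real.sqrt ((m : ℝ) * n) * L * ρ * N * (Real.sqrt ((m : ℝ) * n) / N *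
          dualNorm R (∑ k, Matrix.single (Om k).1 (Om k).2 (((ε k : ℤˣ) : ℤ) : ℝ))) := by
        refine mul_le_mul_of_nonneg_left (Finset.expect_le_expect fun Om _ => ?_) zero_le_two
        exact (contract Om).trans (Finset.expect_le_expect fun ε _ => dual Om ε)
    _ = _ := by
        simp only [← Finset.mul_expect, kappa]
        ring

/-- Restricted strong convexity of the sampled squared norm, outside a small set of samples,
simultaneously for all matrices of bounded regularizer and spikiness. -/
theorem exists_exceptional_samples (hR : IsNorm R) (hm : 0 < m) (hn : 0 < n) (hN : 0 < N)
    {a : ℝ} (ha : 0 < a) :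
    ∃ B : Set (Fin N → Fin m × Fin n),
      (𝔼 Om, B.indicator (fun _ => (1 : ℝ)) Om) ≤ Real.exp (-(N / (8 * a ^ 4))) ∧
      ∀ Om ∉ B, ∀ D : Mat m n, R D ≤ ρ * frobNorm D →
        Real.sqrt ((m : ℝ) * n) * maxNorm D ≤ a * frobNorm D →
        (N / 2 - 4 * a * ρ * N * kappa R N) * frobNorm D ^ 2 ≤
          (m : ℝ) * n * ∑ k, D (Om k).1 (Om k).2 ^ 2 := by
  have : Nonempty (Fin m × Fin n) := ⟨(⟨0, hm⟩, ⟨0, hn⟩)⟩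
  have hmn : (0 : ℝ) < (m : ℝ) * n := by positivity
  have hN' : (0 : ℝ) < N := by exact_mod_cast hN
  set r := Real.sqrt ((m : ℝ) * n) with hr
  have hr0 : 0 < r := Real.sqrt_pos.2 hmn
  have hr2 : r ^ 2 = (m : ℝ) * n := Real.sq_sqrt hmn.le
  -- After normalization, spikiness at most `a` means entries at most `a / √(mn)`; the squares then
  -- range in `[0, a ^ 2]`.
  set L := a / r with hL
  have hL0 : 0 < L := div_pos ha hr0
  have hc : (m : ℝ) * n * L ^ 2 = a ^ 2 := by
    rw [hL, div_pow, hr2]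
    field_simp
  have hslice : ∀ D : Mat m n, D ≠ 0 → R D ≤ ρ * frobNorm D → r * maxNorm D ≤ a * frobNorm D →
      (frobNorm D)⁻¹ • D ∈ unitSlice R ρ L := fun D hD h1 h2 => by
    have hf := frobNorm_pos hD
    refine ⟨?_, ?_, fun p => ?_⟩
    · rw [frobNorm_smul, abs_inv, abs_of_pos hf, inv_mul_cancel₀ hf.ne']
    · rw [map_smul_eq_mul, norm_inv, Real.norm_eq_abs, abs_of_pos hf, ← div_eq_inv_mul,
        div_le_iff₀ hf]
      exact h1
    · rw [Matrix.smul_apply, smul_eq_mul, abs_mul, abs_inv, abs_of_pos hf, ← div_eq_inv_mul,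
        div_le_iff₀ hf, hL, div_mul_eq_mul_div, le_div_iff₀ hr0, mul_comm]
      exact (mul_le_mul_of_nonneg_left (abs_entry_le_maxNorm D p) hr0.le).trans h2
  by_cases hT : Nonempty (unitSlice R ρ L)
  · refine ⟨{Om | (𝔼 Om' : Fin N → Fin m × Fin n, maxDeficit R ρ L Om') + (N : ℝ) / 2 ≤
      maxDeficit R ρ L Om}, ?_,
      fun Om hOm D h1 h2 => ?_⟩
    · refine (expect_indicator_le_of_bounded_diff (t := (N : ℝ) / 2) (by positivity : 0 < a ^ 2)
        (by positivity) hN (maxDeficit R ρ L) fun Om k p => ?_).trans (le_of_eq ?_)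
      · rw [← hc]
        exact abs_maxDeficit_sub_update_le hm hn Om k p
      · congr 2
        field_simp
        ring
    · by_cases hD : D = 0
      · simp [hD, frobNorm_eq_zero.2 rfl]
      have hf := frobNorm_pos hD
      have h3 := le_ciSup (bddAbove_deficit hm hn Om) (⟨_, hslice D hD h1 h2⟩ : unitSlice R ρ L)
      rw [Set.mem_ofPred_eq, not_le] at hOm
      have h4 := expect_maxDeficit_le (N := N) (ρ := ρ) hR hm hn hN hL0.le
      simp only [expect_sqEntry hm hn] at h3
      have h5 : 4 * r * L * ρ * N * kappa R N = 4 * a * ρ * N * kappa R N := by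
        rw [hL]
        field_simp
      rw [← hr, h5] at h4
      have h6 : ∑ k, sqEntry (⟨_, hslice D hD h1 h2⟩ : unitSlice R ρ L) (Om k) =
          (m : ℝ) * n * (∑ k, D (Om k).1 (Om k).2 ^ 2) / frobNorm D ^ 2 := by
        simp only [sqEntry, Matrix.smul_apply, smul_eq_mul, mul_pow]
        rw [Finset.mul_sum, Finset.sum_div]
        exact Finset.sum_congr rfl fun k _ => by field_simp
      rw [h6] at h3
      rw [← le_div_iff₀ (by positivity)]
      have h7 : maxDeficit R ρ L Om = ⨆ D : unitSlice R ρ L,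
        ((N : ℝ) * 1 - ∑ k, sqEntry D (Om k)) := by
        simp only [maxDeficit, expect_sqEntry hm hn]
      rw [← h7] at h3
      linarith
  -- With an empty slice only `D = 0` meets the constraints, so no sample is exceptional.
  · refine ⟨∅, by simpa using (Real.exp_pos _).le, fun Om _ D h1 h2 => ?_⟩
    by_cases hD : D = 0
    · simp [hD, frobNorm_eq_zero.2 rfl]
    · exact absurd ⟨⟨_, hslice D hD h1 h2⟩⟩ hT

end SampledProcess

/-! ### Transfer to the probability space and choice of scale. -/

/-- Independent uniform samples avoid a set with probability given by counting. -/
theorem exists_measurable_avoiding {S ι : Type*} [MeasurableSpace S] [Fintype ι] [Nonempty ι]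
    [MeasurableSpace ι] [MeasurableSingletonClass ι] {P : Measure S} [IsProbabilityMeasure P]
    {N : ℕ} {Om : Fin N → S → ι} (hlaw : ∀ k, HasLaw (Om k) (uniformOn (Set.univ : Set ι)) P)
    (hind : iIndepFun Om P) (B : Set (Fin N → ι)) :
    ∃ A : Set S, MeasurableSet A ∧ P.real A = 1 - 𝔼 ω, B.indicator (fun _ => (1 : ℝ)) ω ∧
      ∀ s ∈ A, (fun k => Om k s) ∉ B := by
  classical
  have hae : AEMeasurable (fun s k => Om k s) P :=
    aemeasurable_pi_lambda _ fun k => (hlaw k).aemeasurable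
  have hmap := (iIndepFun_iff_map_fun_eq_pi_map fun k => (hlaw k).aemeasurable).1 hind
  simp only [(hlaw _).map_eq] at hmap
  have : IsProbabilityMeasure (uniformOn (Set.univ : Set ι)) :=
    isProbabilityMeasure_uniformOn Set.finite_univ Set.univ_nonempty
  have hpt : ∀ ω : Fin N → ι, (Measure.pi fun _ : Fin N => uniformOn (Set.univ : Set ι)).real {ω} =
      (Fintype.card (Fin N → ι) : ℝ)⁻¹ := fun ω => by
    rw [measureReal_def, Measure.pi_singleton]
    simp [uniformOn_univ, ENNReal.toReal_inv]
  have hB : P.real ((fun s k => Om k s) ⁻¹' B) = 𝔼 ω, B.indicator (fun _ => (1 : ℝ)) ω := by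
    have hBm : MeasurableSet B := B.toFinite.measurableSet
    rw [measureReal_def, ← Measure.map_apply_of_aemeasurable hae hBm, hmap, ← measureReal_def,
      ← Set.coe_toFinset B, ← sum_measureReal_singleton, Fintype.expect_eq_sum_div_card]
    simp only [hpt, Finset.sum_const, nsmul_eq_mul, Set.indicator_apply, Set.coe_toFinset,
      Finset.sum_boole, div_eq_mul_inv]
    congr 3
    ext; simp
  -- The indices are only a.e. measurable, so the bad event is enlarged to a measurable hull of
  -- equal measure.
  refine ⟨(toMeasurable P ((fun s k => Om k s) ⁻¹' B))ᶜ, (measurableSet_toMeasurable _ _).compl,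
    ?_, fun s hs h => hs (subset_toMeasurable P _ h)⟩
  rw [probReal_compl_eq_one_sub (measurableSet_toMeasurable _ _), measureReal_def,
    measure_toMeasurable, ← measureReal_def, hB]

/-- The right side equals `(c₀ ^ 4 / 8) Ψ ^ 4 l ^ 2 (n ^ 2 / N)`. The last factor is at least `1`,
and `c₀ ≥ 8 (1 + β) ≥ 1` gives `c₀ ^ 4 / 8 ≥ 1 + β`. -/
theorem le_exponent_of_scale {c₀ β Ψ ψ l n N a : ℝ} (hβ : 0 < β) (hc : 8 * (1 + β) ≤ c₀)
    (hΨ : 0 < Ψ) (hψ : 0 ≤ ψ) (hψΨ : ψ ≤ Ψ) (hl : 0 < l) (hn : 0 < n) (hN : 0 < N)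
    (hNn : N ≤ n ^ 2) (ha : a = 1 / (c₀ * Ψ) * Real.sqrt (N / (n * l))) :
    (1 + β) * ψ ^ 4 * l ^ 2 ≤ N / (8 * a ^ 4) := by
  have hc0 : 0 < c₀ := by linarith
  have h1 : Real.sqrt (N / (n * l)) ^ 4 = (N / (n * l)) ^ 2 := by
    rw [show 4 = 2 * 2 from rfl, pow_mul, Real.sq_sqrt (by positivity)]
  have h2 : N / (8 * a ^ 4) = c₀ ^ 4 / 8 * Ψ ^ 4 * l ^ 2 * (n ^ 2 / N) := by
    rw [ha, mul_pow, h1]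
    field_simp
  have h3 : 1 ≤ n ^ 2 / N := (one_le_div hN).2 hNn
  have h4 : 1 + β ≤ c₀ ^ 4 / 8 := by
    have : c₀ ≤ c₀ ^ 4 := le_self_pow₀ (by linarith) (by norm_num)
    linarith
  rw [h2]
  calc (1 + β) * ψ ^ 4 * l ^ 2 ≤ c₀ ^ 4 / 8 * Ψ ^ 4 * l ^ 2 := by gcongr
    _ ≤ _ := le_mul_of_one_le_right (by positivity) h3

end MatrixCompletion

/-! ### Assembly of the theorem. -/

theorem theorem2 (β : ℝ) (hβ : 0 < β) :
    ∃ cbar : ℝ, 0 < cbar ∧ ∃ K : ℝ, 0 < K ∧ ∀ c₀ : ℝ, cbar ≤ c₀ →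
      -- dimensions and number of samples
      ∀ m n N : ℕ, 1 ≤ m → m ≤ n → 2 ≤ n → N ≤ n ^ 2 →
      -- decomposable norm regularizer
      ∀ (R : Seminorm ℝ (Mat m n)) (M Mbar : Submodule ℝ (Mat m n)),
        IsNorm R → M ≤ Mbar → Mbar ≠ ⊥ → IsDecomposable R M Mbar →
      -- exponential family whose log-partition function has curvature decaying at most exponentially
      ∀ (ν : Measure ℝ) (G : ℝ → ℝ) (η : ℝ),
        IsLogPartition ν G → 0 < η → (∀ u : ℝ, Real.exp (-(η * |u|)) ≤ deriv (deriv G) u) →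
      -- structured target matrix with bounded entries
      ∀ (Θstar : Mat m n) (α : ℝ),
        Θstar ∈ M → 0 < α → maxNorm Θstar ≤ α / Real.sqrt ((m : ℝ) * n) →
      -- sample size
        c₀ * psiMax R Mbar ^ 2 * (n * Real.log n) ≤ N →
      -- observations
      ∀ {S : Type*} [MeasurableSpace S] (P : Measure S) [IsProbabilityMeasure P]
        (Om : Fin N → S → Fin m × Fin n) (X : Fin m → Fin n → S → ℝ),
        IsObservationModel P ν G Θstar Om X →
      -- with high probability, the lower bound holds for every estimate of low spikiness
      ∃ A : Set S, MeasurableSet A ∧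
        1 - 4 * Real.exp (-((1 + β) * psiMin R ^ 4 * Real.log n ^ 2)) < P.real A ∧
        ∀ s ∈ A, ∀ (lam : ℝ) (Θhat : Mat m n), 0 < lam →
          (m : ℝ) * n / N *
              dualNorm R (proj (fun k => Om k s)
                (Matrix.of fun i j => X i j s - deriv G (Θstar i j))) ≤ lam / 2 →
          IsEstimate G R lam α (fun k => Om k s) (Matrix.of fun i j => X i j s) Θhat →
          spikiness (Θhat - Θstar) ≤
              1 / (c₀ * psiMax R Mbar) * Real.sqrt (N / (n * Real.log n)) →
          muL R N η α K c₀ * frobNorm (Θhat - Θstar) ^ 2 ≤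
            (m : ℝ) * n / N *
              ∑ k, bregman G (Θhat (Om k s).1 (Om k s).2) (Θstar (Om k s).1 (Om k s).2) := by
  -- `K = 1 / 4` is the Taylor factor `1 / 2` times the half left after a deviation of `N / 2`.
  refine ⟨8 * (1 + β), by positivity, 1 / 4, by norm_num, ?_⟩
  intro c₀ hc m n N hm hmn hn hNn R M Mbar hR hM hMbar hdec ν G η hG hη hcurv Θstar α hΘM hα hΘmax
    hN S _ P _ Om X hobs
  have hc0 : 0 < c₀ := by linarith
  have hΨ := psiMax_pos hR hMbar
  have hn' : (0 : ℝ) < n := by positivity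
  have hm' : (0 : ℝ) < m := by positivity
  have hl : 0 < Real.log n := Real.log_pos (by exact_mod_cast hn)
  have hN0' : (0 : ℝ) < N := lt_of_lt_of_le (by positivity) hN
  have hN0 : 0 < N := by exact_mod_cast hN0'
  have hNn' : (N : ℝ) ≤ (n : ℝ) ^ 2 := by exact_mod_cast hNn
  have : Nonempty (Fin m × Fin n) := ⟨(⟨0, by omega⟩, ⟨0, by omega⟩)⟩
  set w := Real.sqrt (N / (n * Real.log n)) with hw
  have hw0 : 0 < w := Real.sqrt_pos.2 (by positivity)
  set a := 1 / (c₀ * psiMax R Mbar) * w with ha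
  have ha0 : 0 < a := by positivity
  obtain ⟨B, hB, hBgood⟩ := exists_exceptional_samples (ρ := 4 * psiMax R Mbar) (N := N) hR
    (by omega : 0 < m) (by omega : 0 < n) hN0 ha0
  obtain ⟨A, hA, hPA, hAB⟩ := exists_measurable_avoiding hobs.om_law hobs.om_indep B
  refine ⟨A, hA, ?_, fun s hs lam Θhat hlam hdual hest hspike => ?_⟩
  · have h1 : Real.exp (-(N / (8 * a ^ 4))) ≤
        Real.exp (-((1 + β) * psiMin R ^ 4 * Real.log n ^ 2)) :=
      Real.exp_le_exp.2 (neg_le_neg (le_exponent_of_scale hβ hc hΨ (psiMin_nonneg R)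
        (psiMin_le_psiMax hMbar) hl hn' hN0' hNn' ha))
    have h2 := Real.exp_pos (-((1 + β) * psiMin R ^ 4 * Real.log n ^ 2))
    rw [hPA]
    linarith
  set Oms : Fin N → Fin m × Fin n := fun k => Om k s with hOms
  set r := α / Real.sqrt ((m : ℝ) * n) with hr
  set D := Θhat - Θstar with hD
  have hbreg : ∀ k, Real.exp (-(η * r)) / 2 * D (Oms k).1 (Oms k).2 ^ 2 ≤
      bregman G (Θhat (Oms k).1 (Oms k).2) (Θstar (Oms k).1 (Oms k).2) := fun k => by
    refine bregman_lower_bound (r := r) hG.analytic (fun u hu => ?_)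
      ((abs_entry_le_maxNorm Θhat (Oms k)).trans hest.1)
      ((abs_entry_le_maxNorm Θstar (Oms k)).trans hΘmax)
    exact (Real.exp_le_exp.2 (neg_le_neg (mul_le_mul_of_nonneg_left hu hη.le))).trans (hcurv u)
  have hcone : R D ≤ 4 * psiMax R Mbar * frobNorm D := by
    refine hest.regularizer_error_le hR hdec hlam hΘM hΘmax hdual
      (Finset.sum_nonneg fun k _ => le_trans (by positivity) (hbreg k))
  have hsp : Real.sqrt ((m : ℝ) * n) * maxNorm D ≤ a * frobNorm D := by
    -- At `D = 0` the spikiness is `0 / 0 = 0`, so its hypothesis carries no information.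
    by_cases hD0 : D = 0
    · simp [hD0, maxNorm, frobNorm_eq_zero.2 rfl]
    · exact (div_le_iff₀ (frobNorm_pos hD0)).1 hspike
  have hmain := hBgood Oms (hAB s hs) D hcone hsp
  set Q := ∑ k, D (Oms k).1 (Oms k).2 ^ 2 with hQ
  have hQ0 : 0 ≤ Q := Finset.sum_nonneg fun k _ => sq_nonneg _
  have hsum : Real.exp (-(η * r)) / 2 * Q ≤
      ∑ k, bregman G (Θhat (Oms k).1 (Oms k).2) (Θstar (Oms k).1 (Oms k).2) := by
    rw [hQ, Finset.mul_sum]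
    exact Finset.sum_le_sum fun k _ => hbreg k
  have hκ := hR.kappa_nonneg N
  have hq : Real.sqrt (N * kappa R N ^ 2 / (n * Real.log n)) = w * kappa R N := by
    rw [hw, show (N : ℝ) * kappa R N ^ 2 / (n * Real.log n) =
      N / (n * Real.log n) * kappa R N ^ 2 by ring, Real.sqrt_mul (by positivity),
      Real.sqrt_sq hκ]
  have hr0 : 0 ≤ r := by positivity
  have hexp : Real.exp (-(2 * η * α / Real.sqrt ((m : ℝ) * n))) ≤ Real.exp (-(η * r)) := by
    rw [show 2 * η * α / Real.sqrt ((m : ℝ) * n) = 2 * (η * r) by rw [hr]; ring]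
    exact Real.exp_le_exp.2 (by nlinarith [mul_nonneg hη.le hr0])
  -- `16 = 4 · 4`: the process bound times the cone constant. The factor `Ψ` cancels against the one
  -- in `a`.
  have hcoef : (N / 2 - 4 * a * (4 * psiMax R Mbar) * N * kappa R N) =
      N * (1 / 2 - 16 / c₀ * (w * kappa R N)) := by
    rw [ha]
    field_simp
    ring
  have hscaled : (1 / 2 - 16 / c₀ * (w * kappa R N)) * frobNorm D ^ 2 ≤
      (m : ℝ) * n / N * Q := by
    rw [hcoef] at hmain
    rw [div_mul_eq_mul_div ((m : ℝ) * n), le_div_iff₀ hN0']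
    linarith
  rw [muL, hq]
  set e := Real.exp (-(2 * η * α / Real.sqrt ((m : ℝ) * n))) with he
  have he0 : 0 < e := Real.exp_pos _
  have hf := sq_nonneg (frobNorm D)
  have hwκ : 0 ≤ 1 / c₀ * (w * kappa R N) := by positivity
  calc e * (1 / 4 - 64 / c₀ * (w * kappa R N)) * frobNorm D ^ 2
      ≤ e / 2 * ((1 / 2 - 16 / c₀ * (w * kappa R N)) * frobNorm D ^ 2) := by
        have h1 : 1 / 4 - 64 / c₀ * (w * kappa R N) ≤
            1 / 2 * (1 / 2 - 16 / c₀ * (w * kappa R N)) := by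
          have : 64 / c₀ * (w * kappa R N) = 64 * (1 / c₀ * (w * kappa R N)) := by ring
          have : 16 / c₀ * (w * kappa R N) = 16 * (1 / c₀ * (w * kappa R N)) := by ring
          linarith
        have h2 := mul_le_mul_of_nonneg_left (mul_le_mul_of_nonneg_right h1 hf) he0.le
        linarith
    _ ≤ e / 2 * ((m : ℝ) * n / N * Q) := mul_le_mul_of_nonneg_left hscaled (by positivity)
    _ ≤ Real.exp (-(η * r)) / 2 * ((m : ℝ) * n / N * Q) := by gcongr
    _ = (m : ℝ) * n / N * (Real.exp (-(η * r)) / 2 * Q) := by ring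
    _ ≤ _ := mul_le_mul_of_nonneg_left hsum (by positivity)
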